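/- Let $d\in\mathbb N$. The direction of $g=(g_1,\dots,g_d)\in\mathbb R^d$ is the vector $\theta(g)=(\theta_1,\dots,\theta_{d-1})$ of its hyper-spherical angles $$\theta_z=\operatorname{arctan2}\Big(\sqrt{\textstyle\sum_{k=z+1}^{d}g_k^2},\,g_z\Big)\ (1\le z\le d-2),\qquad \theta_{d-1}=\operatorname{arctan2}(g_d,g_{d-1}),$$ where $\operatorname{arctan2}(y,x)\in(-\pi,\pi]$ is the polar angle of the point $(x,y)$, with the convention $\operatorname{arctan2}(0,0)=0$. Let $\ell(w;s)$ be a loss function of $w\in\mathbb R^d$ and of a data point $s$, fix weights $w\in\mathbb R^d$ at which $v\mapsto\ell(v;s)$ is differentiable for every $s$, let $s\mapsto\nabla_w\ell(w;s)$ be measurable, and fix a clipping threshold $C>0$. Let $s_1,s_2,\dots$ be i.i.d. random data points, let $g_j=\nabla_w\ell(w;s_j)$ be the per-sample gradients, $\tilde g_j=g_j/\max\{1,\|g_j\|/C\}$ the clipped gradients, and $\tilde\theta_j=(\tilde\theta_{j1},\dots,\tilde\theta_{j(d-1)})=\theta(\tilde g_j)$ their directions. For a batch size $B$ let $\bar\theta^{(B)}=\frac1B\sum_{j=1}^B\tilde\theta_j$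 be the averaged direction. **Theorem (Modeling of the Averaged Directions of Gradients).** For every $z$, the angles $\tilde\theta_{jz}$ have a finite second moment, and their expectation $m_z=\mathbb E(\tilde\theta_{jz})$ and variance $v_z=\operatorname{var}(\tilde\theta_{jz})$ do not depend on $j$. For every $z$ with $v_z>0$: 1. as $B\to\infty$, $\dfrac{\bar\theta^{(B)}_z-m_z}{\sqrt{v_z/B}}$ converges in distribution to the standard Gaussian $\mathcal N(0,1)$; 2. the law of $\bar\theta^{(B)}_z$ is asymptotically that of the Gaussian density with mean $m_z$ and variance $v_z/B$, in the sense that $$\lim_{B\to\infty}\ \sup_{x\in\mathbb R}\left|\Pr\big(\bar\theta^{(B)}_z\le x\big)-\int_{-\infty}^{x}\sqrt{\frac{B}{2\pi v_z}}\exp\Big(-\frac{B\,(t-m_z)^2}{2v_z}\Big)\,dt\right|=0.$$ Moreover (whatever the variances), the averaged direction concentrates around the mean direction $m=(m_1,\dots,m_{d-1})$: for every $\varepsilon>0$, $\lim_{B\to\infty}\Pr\big(\|\bar\theta^{(B)}-m\|\ge\varepsilon\big)=0$. -/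

import Mathlib

open MeasureTheory ProbabilityTheory Filter Topology

noncomputable section

/-- The two-argument arctangent. At `(0, 0)`, where the angle is undefined, the value is `0`. -/
def arctan2 (y x : ℝ) : ℝ :=
  if 0 < x then Real.arctan (y / x)
  else if x < 0 then
    if 0 ≤ y then Real.arctan (y / x) + Real.pi else Real.arctan (y / x) - Real.pi
  else
    if 0 < y then Real.pi / 2 else if y < 0 then -(Real.pi / 2) else 0

/-- Hyper-spherical angles of a vector of `ℝ^d`. Both angles and coordinates are indexed from `0`.
Every angle but the last is `arctan2 (√(sum of the squares of the later coordinates), g z)`,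
the last one is `arctan2 (g (d - 1), g (d - 2))`. -/
def sphericalAngle {d : ℕ} (g : EuclideanSpace ℝ (Fin d)) (z : Fin (d - 1)) : ℝ :=
  if (z : ℕ) + 2 < d then
    arctan2 (√(∑ k : Fin d with z.val < k.val, g k ^ 2)) (g ⟨z, by omega⟩)
  else arctan2 (g ⟨z + 1, by omega⟩) (g ⟨z, by omega⟩)

/-- The direction of a vector: the vector of its `d - 1` hyper-spherical angles. -/
def direction {d : ℕ} (g : EuclideanSpace ℝ (Fin d)) : EuclideanSpace ℝ (Fin (d - 1)) :=
  WithLp.toLp 2 (sphericalAngle g)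

/-- Gradient clipping with threshold `C`. -/
def clip {d : ℕ} (C : ℝ) (g : EuclideanSpace ℝ (Fin d)) : EuclideanSpace ℝ (Fin d) :=
  (max 1 (‖g‖ / C))⁻¹ • g

/-- Direction of the clipped gradient at `w` of the loss `ℓ` on the single data point `s`. -/
def clippedDirection {d : ℕ} {S : Type*} (ℓ : EuclideanSpace ℝ (Fin d) → S → ℝ)
    (w : EuclideanSpace ℝ (Fin d)) (C : ℝ) (s : S) : EuclideanSpace ℝ (Fin (d - 1)) :=
  direction (clip C (gradient (fun v => ℓ v s) w))

/-- Average of the first `B` terms of a sequence of (random) directions. -/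
def averagedDirection {Ω : Type*} {n : ℕ} (θ : ℕ → Ω → EuclideanSpace ℝ (Fin n)) (B : ℕ) (ω : Ω) :
    EuclideanSpace ℝ (Fin n) :=
  (B : ℝ)⁻¹ • ∑ j ∈ Finset.range B, θ j ω

end

/-! Each angle is a measurable function of the data point with values in `[-π, π]`, so the
directions are i.i.d. with all moments, and the classical limit theorems apply. The central limit
theorem, used one coordinate at a time, gives the Gaussian limit. Pólya's theorem makes the
convergence of distribution functions uniform, which allows the comparison with a Gaussian whose
variance shrinks with the batch. Concentration is the law of large numbers for vectors. -/

lemma measurable_arctan2 : Measurable (fun p : ℝ × ℝ => arctan2 p.1 p.2) := by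
  unfold arctan2
  have h1 : Measurable (fun p : ℝ × ℝ => Real.arctan (p.1 / p.2)) :=
    (measurable_fst.div measurable_snd).arctan
  refine Measurable.ite (measurableSet_lt measurable_const measurable_snd) h1 ?_
  refine Measurable.ite (measurableSet_lt measurable_snd measurable_const) ?_ ?_
  · exact Measurable.ite (measurableSet_le measurable_const measurable_fst)
      (h1.add_const _) (h1.sub_const _)
  · refine Measurable.ite (measurableSet_lt measurable_const measurable_fst) measurable_const ?_
    exact Measurable.ite (measurableSet_lt measurable_fst measurable_const)
      measurable_const measurable_const

lemma abs_arctan2_le (y x : ℝ) : |arctan2 y x| ≤ Real.pi := by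
  have h1 := Real.neg_pi_div_two_lt_arctan (y / x)
  have h2 := Real.arctan_lt_pi_div_two (y / x)
  have hpi := Real.pi_pos
  unfold arctan2
  split_ifs with hx hx' hy hy' hy''
  · rw [abs_le]; constructor <;> linarith
  · have : Real.arctan (y / x) ≤ 0 :=
      Real.arctan_le_zero.2 (div_nonpos_of_nonneg_of_nonpos hy hx'.le)
    rw [abs_le]; constructor <;> linarith
  · have : 0 ≤ Real.arctan (y / x) :=
      Real.arctan_nonneg.2 (div_nonneg_of_nonpos (not_le.1 hy).le hx'.le)
    rw [abs_le]; constructor <;> linarith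
  all_goals rw [abs_le]; constructor <;> linarith

lemma measurable_sphericalAngle {d : ℕ} (z : Fin (d - 1)) :
    Measurable (fun g : EuclideanSpace ℝ (Fin d) => sphericalAngle g z) := by
  unfold sphericalAngle
  split_ifs
  · exact measurable_arctan2.comp
      (f := fun g : EuclideanSpace ℝ (Fin d) => (√(∑ k : Fin d with z.val < k.val, g k ^ 2), _))
      (by fun_prop)
  · exact measurable_arctan2.comp
      (f := fun g : EuclideanSpace ℝ (Fin d) => (g ⟨z + 1, by omega⟩, _)) (by fun_prop)

lemma abs_sphericalAngle_le {d : ℕ} (g : EuclideanSpace ℝ (Fin d)) (z : Fin (d - 1)) :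
    |sphericalAngle g z| ≤ Real.pi := by
  unfold sphericalAngle
  split_ifs <;> exact abs_arctan2_le _ _

lemma measurable_direction {d : ℕ} :
    Measurable (direction : EuclideanSpace ℝ (Fin d) → EuclideanSpace ℝ (Fin (d - 1))) :=
  (WithLp.measurable_toLp 2 _).comp (measurable_pi_lambda _ measurable_sphericalAngle)

lemma measurable_clip {d : ℕ} (C : ℝ) :
    Measurable (clip C : EuclideanSpace ℝ (Fin d) → EuclideanSpace ℝ (Fin d)) := by
  unfold clip
  fun_prop

/-- Pólya's theorem: pointwise convergence of distribution functions to a continuous one is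
uniform. -/
lemma eventually_forall_abs_sub_lt_of_monotone {ι : Type*} {l : Filter ι} {F : ι → ℝ → ℝ}
    {G : ℝ → ℝ} (hF : ∀ i, Monotone (F i)) (hF0 : ∀ i x, 0 ≤ F i x) (hF1 : ∀ i x, F i x ≤ 1)
    (hG : Monotone G) (hGc : Continuous G) (hG0 : Tendsto G atBot (𝓝 0))
    (hG1 : Tendsto G atTop (𝓝 1)) (h : ∀ x, Tendsto (fun i => F i x) l (𝓝 (G x)))
    {ε : ℝ} (hε : 0 < ε) : ∀ᶠ i in l, ∀ x, |F i x - G x| < ε := by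
  -- Grid of quantiles at the levels `k / N`: one `1 / N` is lost to the grid spacing, another to
  -- the approximation at the grid points.
  obtain ⟨N, hN⟩ := exists_nat_gt (2 / ε)
  have hN0 : (0 : ℝ) < N := (by positivity : 0 < 2 / ε).trans hN
  have hNε : 2 < N * ε := (div_lt_iff₀ hε).1 hN
  -- Only interior levels: `G` need not attain `0` or `1`. Near the ends the bounds `0 ≤ F ≤ 1`
  -- replace a quantile.
  have hq : ∀ k : ℕ, 0 < k → k < N → ∃ x, G x = k / N := by
    intro k hk0 hkN
    have hk1 : (0 : ℝ) < k / N := by positivity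
    have hk2 : (k : ℝ) / N < 1 := (div_lt_one hN0).2 (by exact_mod_cast hkN)
    obtain ⟨a, ha⟩ := (hG0.eventually (gt_mem_nhds hk1)).exists
    obtain ⟨b, hb⟩ := (hG1.eventually (lt_mem_nhds hk2)).exists
    exact mem_range_of_exists_le_of_exists_ge hGc ⟨a, ha.le⟩ ⟨b, hb.le⟩
  choose! q hq using hq
  have hev : ∀ᶠ i in l, ∀ k ∈ Finset.range N, |F i (q k) - G (q k)| < 1 / N := by
    refine (Finset.eventually_all _).2 fun k _ => ?_
    have := Metric.tendsto_nhds.1 (h (q k)) (1 / N) (by positivity)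
    simpa only [Real.dist_eq] using this
  have hG0' : ∀ x, 0 ≤ G x := fun x => hG.le_of_tendsto hG0 x
  have hG1' : ∀ x, G x ≤ 1 := fun x => hG.ge_of_tendsto hG1 x
  filter_upwards [hev] with i hi x
  have hmem : ∀ k : ℕ, 0 < k → k < N → |N * F i (q k) - k| < 1 := by
    intro k hk0 hkN
    have := hi k (Finset.mem_range.2 hkN)
    rw [hq k hk0 hkN, lt_div_iff₀ hN0] at this
    calc |N * F i (q k) - k| = |(F i (q k) - k / N) * N| := by
          congr 1
          field_simp
      _ = |F i (q k) - k / N| * N := by rw [abs_mul, abs_of_pos hN0]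
      _ < 1 := this
  have hNx : 0 ≤ N * G x := mul_nonneg hN0.le (hG0' x)
  suffices hs : N * F i x - N * G x < N * ε ∧ N * G x - N * F i x < N * ε by
    rw [abs_lt]
    constructor <;> nlinarith [hs.1, hs.2]
  constructor
  · have hm := Nat.lt_floor_add_one (N * G x)
    have hm' := Nat.floor_le hNx
    set m := ⌊N * G x⌋₊
    rcases lt_or_ge (m + 1) N with hlt | hge
    · have hk := hmem (m + 1) m.succ_pos hlt
      have hGq : G x < G (q (m + 1)) := by
        rw [hq _ m.succ_pos hlt, lt_div_iff₀ hN0]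
        push_cast
        linarith
      have := mul_le_mul_of_nonneg_left (hF i (hG.reflect_lt hGq).le) hN0.le
      push_cast at hk
      linarith [(abs_lt.1 hk).2]
    · have hge' : (N : ℝ) ≤ m + 1 := by exact_mod_cast hge
      have := mul_le_mul_of_nonneg_left (hF1 i x) hN0.le
      linarith
  · rcases le_or_gt (N * G x) 1 with hle | hgt
    · have := mul_nonneg hN0.le (hF0 i x)
      linarith
    · have hm := Nat.le_ceil (N * G x)
      have hm' := Nat.ceil_lt_add_one hNx
      -- Ceiling minus one, not the floor: `k < N * G x` must be strict for monotonicity to place `q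
      -- k` to the left of `x`.
      obtain ⟨k, hk⟩ : ∃ k, ⌈N * G x⌉₊ = k + 1 :=
        Nat.exists_eq_succ_of_ne_zero (Nat.ceil_pos.2 (by linarith)).ne'
      rw [hk] at hm hm'
      push_cast at hm hm'
      have hk0 : 0 < k := by
        rcases Nat.eq_zero_or_pos k with rfl | h0
        · norm_num at hm
          linarith
        · exact h0
      have hkN : k < N := by
        have : (k : ℝ) < N := by nlinarith [hG1' x]
        exact_mod_cast this
      have hb := hmem k hk0 hkN
      have hGq : G (q k) < G x := by
        rw [hq _ hk0 hkN, div_lt_iff₀ hN0]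
        linarith
      have := mul_le_mul_of_nonneg_left (hF i (hG.reflect_lt hGq).le) hN0.le
      linarith [(abs_lt.1 hb).1]

/-- A distribution function is right continuous, and its jump at `x` is the mass of `{x}`. -/
lemma continuous_cdf_of_forall_singleton (ν : Measure ℝ) [IsProbabilityMeasure ν]
    (hν : ∀ x, ν {x} = 0) : Continuous (cdf ν) := by
  refine continuous_iff_continuousAt.2 fun x => ?_
  rw [continuousAt_iff_continuous_left'_right', (monotone_cdf ν).continuousWithinAt_Iio_iff_leftLim_eq]
  refine ⟨?_, ((cdf ν).right_continuous x).mono Set.Ioi_subset_Ici_self⟩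
  have h := hν x
  rw [← measure_cdf ν, StieltjesFunction.measure_singleton, ENNReal.ofReal_eq_zero] at h
  linarith [(monotone_cdf ν).leftLim_le (le_refl x)]

/-- Convergence in distribution to a law without atoms is uniform convergence of the distribution
functions. -/
lemma TendstoInDistribution.eventually_forall_abs_sub_lt {Ω Ω' : Type*} [MeasurableSpace Ω]
    [MeasurableSpace Ω'] {μ : Measure Ω} [IsProbabilityMeasure μ] {μ' : Measure Ω'}
    [IsProbabilityMeasure μ'] {X : ℕ → Ω → ℝ} {Y : Ω' → ℝ} {ν : Measure ℝ}
    [IsProbabilityMeasure ν] (hY : HasLaw Y ν μ') (hν : ∀ x, ν {x} = 0)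
    (h : TendstoInDistribution X atTop Y (fun _ => μ) μ') {ε : ℝ} (hε : 0 < ε) :
    ∀ᶠ n in atTop, ∀ x, |μ.real {ω | X n ω ≤ x} - ν.real (Set.Iic x)| < ε := by
  have hX : ∀ n x, (μ.map (X n)).real (Set.Iic x) = μ.real {ω | X n ω ≤ x} := fun n x =>
    map_measureReal_apply_of_aemeasurable (h.forall_aemeasurable n) measurableSet_Iic
  have hmono : ∀ n, Monotone fun x => μ.real {ω | X n ω ≤ x} := fun n x y hxy =>
    measureReal_mono fun ω (hω : X n ω ≤ x) => hω.trans hxy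
  have key := eventually_forall_abs_sub_lt_of_monotone (l := atTop)
    (F := fun n x => μ.real {ω | X n ω ≤ x}) (G := cdf ν) hmono
    (fun _ _ => measureReal_nonneg) (fun _ _ => measureReal_le_one) (monotone_cdf ν)
    (continuous_cdf_of_forall_singleton ν hν) (tendsto_cdf_atBot ν) (tendsto_cdf_atTop ν) ?_ hε
  · simpa only [cdf_eq_real] using key
  · intro x
    -- Portmanteau: the frontier of the half-line is `{x}`, a null set.
    have := ProbabilityMeasure.tendsto_measure_of_null_frontier_of_tendsto' h.tendsto
      (E := Set.Iic x) (by
        simp only [ProbabilityMeasure.coe_mk, frontier_Iic, hY.map_eq, hν])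
    simp only [ProbabilityMeasure.coe_mk, hY.map_eq] at this
    have := (ENNReal.tendsto_toReal (measure_ne_top ν _)).comp this
    rw [cdf_eq_real]
    exact this.congr fun n => hX n x

/-- The central limit theorem for averages, normalized by the standard deviation of the average. -/
lemma tendstoInDistribution_average_sub_div {Ω : Type*} [MeasurableSpace Ω] {μ : Measure Ω}
    [IsProbabilityMeasure μ] {X : ℕ → Ω → ℝ} (hX : MemLp (X 0) 2 μ) (hindep : iIndepFun X μ)
    (hident : ∀ j, IdentDistrib (X j) (X 0) μ μ) (hv : 0 < Var[X 0; μ]) :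
    TendstoInDistribution
      (fun (n : ℕ) ω => ((n : ℝ)⁻¹ * ∑ j ∈ Finset.range n, X j ω - μ[X 0]) / √(Var[X 0; μ] / n))
      atTop (id : ℝ → ℝ) (fun _ => μ) (gaussianReal 0 1) := by
  have hs : √Var[X 0; μ] ≠ 0 := (Real.sqrt_pos.2 hv).ne'
  have hY : HasLaw (fun x : ℝ => √Var[X 0; μ] * x) (gaussianReal 0 Var[X 0; μ].toNNReal)
      (gaussianReal 0 1) := by
    refine ⟨by fun_prop, ?_⟩
    rw [gaussianReal_map_const_mul]
    congr 1
    · simp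
    · ext
      simp [Real.sq_sqrt hv.le, hv.le]
  have h := (tendstoInDistribution_inv_sqrt_mul_sum_sub hY hX hindep hident).continuous_comp
    (g := fun x => x / √Var[X 0; μ]) (by fun_prop)
  refine h.congr (fun n => .of_forall fun ω => ?_) (.of_forall fun x => ?_)
  · rcases Nat.eq_zero_or_pos n with rfl | hn
    -- For `n = 0` both sides are `0`, by division by zero.
    · simp
    have hn' : (0 : ℝ) < n := by exact_mod_cast hn
    have hsn : √(n : ℝ) ≠ 0 := (Real.sqrt_pos.2 hn').ne'
    simp only [Function.comp_apply, Real.sqrt_div hv.le]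
    field_simp
    rw [Real.sq_sqrt hn'.le]
  · simp only [Function.comp_apply, id]
    field_simp

/-- The affine map `t ↦ √v * t + m` carries the standard Gaussian to the one with mean `m` and
variance `v`. -/
lemma gaussianReal_Iic_eq_standard (m : ℝ) {v : ℝ} (hv : 0 < v) (x : ℝ) :
    ∫ t in Set.Iic x, gaussianPDFReal m v.toNNReal t =
      (gaussianReal 0 1).real (Set.Iic ((x - m) / √v)) := by
  have hs : 0 < √v := Real.sqrt_pos.2 hv
  have hmap : (gaussianReal 0 1).map (fun t => √v * t + m) = gaussianReal m v.toNNReal := by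
    have : (fun t => √v * t + m) = (· + m) ∘ (√v * ·) := rfl
    rw [this, ← Measure.map_map (by fun_prop) (by fun_prop), gaussianReal_map_const_mul,
      gaussianReal_map_add_const]
    congr 1
    · simp
    · ext
      simp [Real.sq_sqrt hv.le, hv.le]
  have hpre : (fun t => √v * t + m) ⁻¹' Set.Iic x = Set.Iic ((x - m) / √v) := by
    ext t
    simp only [Set.mem_preimage, Set.mem_Iic]
    rw [le_div_iff₀ hs]
    constructor <;> intro h <;> linarith
  rw [← hpre, ← map_measureReal_apply (by fun_prop) measurableSet_Iic, hmap, measureReal_def,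
    gaussianReal_apply_eq_integral _ (by simpa using hv), ENNReal.toReal_ofReal]
  exact integral_nonneg fun t => gaussianPDFReal_nonneg _ _ t

/-- The distribution function of the average is uniformly asymptotic to the Gaussian one with the
same mean and variance. -/
lemma eventually_forall_abs_average_sub_gaussian_lt {Ω : Type*} [MeasurableSpace Ω]
    {μ : Measure Ω} [IsProbabilityMeasure μ] {A : ℕ → Ω → ℝ} {m v : ℝ} (hv : 0 < v)
    (h : TendstoInDistribution (fun (n : ℕ) ω => (A n ω - m) / √(v / n))
      atTop (id : ℝ → ℝ) (fun _ => μ) (gaussianReal 0 1)) {ε : ℝ} (hε : 0 < ε) :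
    ∀ᶠ n : ℕ in atTop, ∀ x : ℝ, |μ.real {ω | A n ω ≤ x} -
      ∫ t in Set.Iic x, gaussianPDFReal m (v / n).toNNReal t| < ε := by
  have hat : ∀ x, gaussianReal 0 1 {x} = 0 :=
    have := nullSingletonClass_gaussianReal (μ := 0) (v := 1) one_ne_zero
    fun x => measure_singleton x
  filter_upwards [TendstoInDistribution.eventually_forall_abs_sub_lt HasLaw.id hat h hε,
    eventually_gt_atTop 0] with n hn hn0 x
  have hvn : 0 < v / n := div_pos hv (by exact_mod_cast hn0)
  rw [gaussianReal_Iic_eq_standard m hvn x]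
  -- The standardized threshold moves with `n`, so pointwise convergence would not suffice here.
  convert hn ((x - m) / √(v / n)) using 6 with ω
  rw [div_le_div_iff_of_pos_right (Real.sqrt_pos.2 hvn)]
  constructor <;> intro h <;> linarith

lemma averagedDirection_apply {Ω : Type*} {n : ℕ} (θ : ℕ → Ω → EuclideanSpace ℝ (Fin n)) (B : ℕ)
    (ω : Ω) (z : Fin n) :
    averagedDirection θ B ω z = (B : ℝ)⁻¹ * ∑ j ∈ Finset.range B, θ j ω z := by
  simp [averagedDirection]

/-- The weak law of large numbers for averaged random vectors. -/
lemma tendsto_measure_le_norm_averagedDirection_sub {Ω : Type*} [MeasurableSpace Ω]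
    {μ : Measure Ω} [IsProbabilityMeasure μ] {n : ℕ} {θ : ℕ → Ω → EuclideanSpace ℝ (Fin n)}
    (hint : Integrable (θ 0) μ) (hindep : iIndepFun θ μ)
    (hident : ∀ j, IdentDistrib (θ j) (θ 0) μ μ) {ε : ℝ} (hε : 0 < ε) :
    Tendsto (fun B : ℕ => μ {ω | ε ≤ ‖averagedDirection θ B ω -
      WithLp.toLp 2 (fun z => ∫ ω', θ 0 ω' z ∂μ)‖}) atTop (𝓝 0) := by
  have hmean : WithLp.toLp 2 (fun z => ∫ ω', θ 0 ω' z ∂μ) = ∫ ω', θ 0 ω' ∂μ := by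
    ext z
    exact (EuclideanSpace.proj (𝕜 := ℝ) z).integral_comp_comm hint
  have hm : ∀ j, AEMeasurable (θ j) μ := fun j => (hident j).aemeasurable_fst
  have hlim := tendstoInMeasure_of_tendsto_ae (μ := μ) (f := averagedDirection θ)
    (g := fun _ => ∫ ω', θ 0 ω' ∂μ) (fun B => by
      unfold averagedDirection
      exact ((Finset.aemeasurable_fun_sum (Finset.range B) fun j _ => hm j).const_smul
        (B : ℝ)⁻¹).aestronglyMeasurable)
    -- Almost sure convergence implies convergence in measure, as `μ` is finite.
    (strong_law_ae θ hint (fun i j hij => hindep.indepFun hij) hident)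
  rw [hmean]
  exact tendstoInMeasure_iff_norm.1 hlim ε hε

theorem mainTheorem9 {Ω S : Type*} [MeasurableSpace Ω] [MeasurableSpace S]
    (μ : Measure Ω) [IsProbabilityMeasure μ] {d : ℕ}
    -- the loss, the current weights and the clipping threshold
    (ℓ : EuclideanSpace ℝ (Fin d) → S → ℝ) (w : EuclideanSpace ℝ (Fin d)) (C : ℝ) (hC : 0 < C)
    (hdiff : ∀ x : S, DifferentiableAt ℝ (fun v => ℓ v x) w)
    (hmeas : Measurable (fun x : S => gradient (fun v => ℓ v x) w))
    -- the i.i.d. data points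
    (s : ℕ → Ω → S) (hindep : iIndepFun s μ) (hident : ∀ j, IdentDistrib (s j) (s 0) μ μ)
    -- the directions of the clipped per-sample gradients
    (θ : ℕ → Ω → EuclideanSpace ℝ (Fin (d - 1)))
    (hθ : ∀ j ω, θ j ω = clippedDirection ℓ w C (s j ω)) :
    -- expectation and variance of every angle exist and do not depend on the sample
    (∀ j z, MemLp (fun ω => θ j ω z) 2 μ ∧
      (∫ ω, θ j ω z ∂μ) = (∫ ω, θ 0 ω z ∂μ) ∧
      variance (fun ω => θ j ω z) μ = variance (fun ω => θ 0 ω z) μ) ∧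
    (∀ z, 0 < variance (fun ω => θ 0 ω z) μ →
      -- the normalized averaged angle converges in distribution to the standard Gaussian
      TendstoInDistribution
        (fun (B : ℕ) ω => (averagedDirection θ B ω z - ∫ ω', θ 0 ω' z ∂μ) /
          √(variance (fun ω' => θ 0 ω' z) μ / B))
        atTop (id : ℝ → ℝ) (fun _ => μ) (gaussianReal 0 1) ∧
      -- the averaged angle is, uniformly, asymptotically Gaussian with variance of order `1 / B`
      ∀ ε : ℝ, 0 < ε → ∀ᶠ B : ℕ in atTop, ∀ x : ℝ,
        |μ.real {ω | averagedDirection θ B ω z ≤ x} -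
          ∫ t in Set.Iic x, gaussianPDFReal (∫ ω, θ 0 ω z ∂μ)
            (variance (fun ω => θ 0 ω z) μ / B).toNNReal t| < ε) ∧
    -- the averaged direction concentrates around the mean direction
    (∀ ε : ℝ, 0 < ε → Tendsto (fun B : ℕ => μ {ω | ε ≤ ‖averagedDirection θ B ω -
      WithLp.toLp 2 (fun z => ∫ ω', θ 0 ω' z ∂μ)‖}) atTop (𝓝 0)) := by
  have hF : Measurable (clippedDirection ℓ w C) :=
    measurable_direction.comp ((measurable_clip C).comp hmeas)
  obtain rfl : θ = fun j => clippedDirection ℓ w C ∘ s j := by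
    funext j ω
    exact hθ j ω
  have hindepV := hindep.comp (fun _ => clippedDirection ℓ w C) fun _ => hF
  have hidentV := fun j => (hident j).comp hF
  have hcoord : ∀ z, Measurable fun g : EuclideanSpace ℝ (Fin (d - 1)) => g z := fun z => by
    fun_prop
  have hidentC := fun j z => (hidentV j).comp (hcoord z)
  have hmem : ∀ j z, MemLp (fun ω => (clippedDirection ℓ w C ∘ s j) ω z) 2 μ := fun j z =>
    MemLp.of_bound (hidentC j z).aemeasurable_fst.aestronglyMeasurable Real.pi
      (.of_forall fun ω => abs_sphericalAngle_le _ z)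
  refine ⟨fun j z => ⟨hmem j z, (hidentC j z).integral_eq, (hidentC j z).variance_eq⟩,
    fun z hv => ?_, fun ε hε => ?_⟩
  · have hclt := tendstoInDistribution_average_sub_div (hmem 0 z)
      (hindepV.comp (fun _ g => g z) fun _ => hcoord z) (fun j => hidentC j z) hv
    have hclt' : TendstoInDistribution
        (fun (B : ℕ) ω => (averagedDirection (fun j => clippedDirection ℓ w C ∘ s j) B ω z -
            ∫ ω', (clippedDirection ℓ w C ∘ s 0) ω' z ∂μ) /
          √(variance (fun ω' => (clippedDirection ℓ w C ∘ s 0) ω' z) μ / B))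
        atTop (id : ℝ → ℝ) (fun _ => μ) (gaussianReal 0 1) := by
      simp only [averagedDirection_apply]
      exact hclt
    exact ⟨hclt', fun ε hε => eventually_forall_abs_average_sub_gaussian_lt hv hclt' hε⟩
  · refine tendsto_measure_le_norm_averagedDirection_sub ?_ hindepV hidentV hε
    exact Integrable.of_eval_piLp fun z => (hmem 0 z).integrable one_le_two
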